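/- Let $m\ge 1$ and let $K$ be a field, of any characteristic, that is quadratically closed in the following sense: every nonconstant polynomial of degree at most $2m$ in $K[x]$ has a root in $K$. Let $p(x_1,\dots,x_m)=\sum_{\sigma\in S_m}c_\sigma\,x_{\sigma(1)}\cdots x_{\sigma(m)}$, with $c_\sigma\in K$, be a multilinear polynomial of degree $m$ in the noncommuting variables $x_1,\dots,x_m$, and let $\operatorname{Im} p=\{p(a_1,\dots,a_m): a_1,\dots,a_m\in M_2(K)\}$ be its image on the algebra $M_2(K)$ of $2\times 2$ matrices. Let $\tilde K\subseteq M_2(K)$ denote the set of matrices that are neither nilpotent nor diagonalizable over $K$. Then $\operatorname{Im} p$ is one of the following sets: $\{0\}$; the set of all scalar matrices; the set $sl_2(K)$ of all matrices of trace zero; $M_2(K)$; or $M_2(K)\setminus\tilde K$. -/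

import Mathlib

/-- `p ∈ K⟨x₁,…,x_m⟩` is multilinear of degree `m`:
`p = ∑_{σ ∈ S_m} c_σ x_{σ(1)} ⋯ x_{σ(m)}` with coefficients `c_σ ∈ K`. -/
def IsMultilinearPoly {K : Type*} [Field K] {m : ℕ} (p : FreeAlgebra K (Fin m)) : Prop :=
  ∃ c : Equiv.Perm (Fin m) → K,
    p = ∑ σ : Equiv.Perm (Fin m),
      c σ • (List.ofFn fun i : Fin m => FreeAlgebra.ι K (σ i)).prod

/-- The image of a noncommutative polynomial `p` on a `K`-algebra `R`: the set of all values
`p(a₁,…,a_m)` with `a₁,…,a_m ∈ R`. -/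
def polyImage {K : Type*} [Field K] (R : Type*) [Ring R] [Algebra K R] {m : ℕ}
    (p : FreeAlgebra K (Fin m)) : Set R :=
  {A | ∃ a : Fin m → R, FreeAlgebra.lift K a p = A}

/-- Quadratically closed with respect to polynomials of degree `d`: every nonconstant polynomial
of degree at most `2 * d` in `K[x]` has a root in `K`. -/
def IsQuadraticallyClosed (K : Type*) [Field K] (d : ℕ) : Prop :=
  ∀ f : Polynomial K, 0 < f.natDegree → f.natDegree ≤ 2 * d → ∃ x : K, f.IsRoot x

/-- The set of scalar matrices in `M_n(K)`. -/
def scalarMatrices (n : ℕ) (K : Type*) [Field K] : Set (Matrix (Fin n) (Fin n) K) :=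
  {A | ∃ c : K, A = Matrix.scalar (Fin n) c}

/-- The set `sl_n(K)` of matrices of trace zero. -/
def slMatrices (n : ℕ) (K : Type*) [Field K] : Set (Matrix (Fin n) (Fin n) K) :=
  {A | A.trace = 0}

/-- `A` is conjugate over `K` to a diagonal matrix. -/
def IsDiagonalizableMatrix {n : ℕ} {K : Type*} [Field K] (A : Matrix (Fin n) (Fin n) K) : Prop :=
  ∃ (P : GL (Fin n) K) (d : Fin n → K),
    A = (P : Matrix (Fin n) (Fin n) K) * Matrix.diagonal d *
      ((P⁻¹ : GL (Fin n) K) : Matrix (Fin n) (Fin n) K)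

/-- The set `K̃` of non-nilpotent, non-diagonalizable matrices in `M_2(K)`. -/
def tildeK (K : Type*) [Field K] : Set (Matrix (Fin 2) (Fin 2) K) :=
  {A | ¬ IsNilpotent A ∧ ¬ IsDiagonalizableMatrix A}

/-! The image `S` of `p` is the range of a conjugation-equivariant multilinear map `F`, hence is
closed under conjugation and scaling. A nonscalar 2×2 matrix is determined up to conjugacy by trace
and determinant (`IsConjCone.mem_of_trace_det`), so it is enough to find which ratios tr² : det
occur. If all values are scalar, `S` is `{0}` or the scalars. Otherwise torus weights
(`ConjEquivariant.weight`) show that some tuple of matrix units has a nonzero strictly upper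
triangular value.

`S` need not be linear, but it contains the span of two values whose tuples differ in one
coordinate. By `cross_mul_eq_of_update`, two functions, polynomial on lines, that are not
proportional globally already fail to be so across such a step, which yields a useful pencil. If all
traces vanish, a pencil with a member of nonzero determinant gives all of `sl_2`. If some trace is
nonzero, pencils give every diagonal matrix (`ConjEquivariant.diagonal_mem`), so `S` contains all
diagonalizable and nilpotent matrices. What remains, `tildeK`, is one orbit under conjugation and
nonzero scaling, so `S` contains all of it or none. -/

open Polynomial

/-! ### Functions polynomial on lines, and propagation of proportionality -/

/-- The restriction of `f` to every affine line is given by a polynomial in the parameter. -/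
def PolynomialOnLines (K : Type*) [Field K] {E : Type*} [AddCommGroup E] [Module K E]
    (f : E → K) : Prop :=
  ∀ a b : E, ∃ q : K[X], ∀ s : K, f (a + s • b) = q.eval s

namespace PolynomialOnLines

variable {K : Type*} [Field K] {E : Type*} [AddCommGroup E] [Module K E] {f g : E → K}

theorem const (c : K) : PolynomialOnLines K (fun _ : E => c) :=
  fun _ _ => ⟨C c, fun _ => by simp⟩

theorem add (hf : PolynomialOnLines K f) (hg : PolynomialOnLines K g) :
    PolynomialOnLines K (fun x => f x + g x) := by
  intro a b
  obtain ⟨q, hq⟩ := hf a b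
  obtain ⟨r, hr⟩ := hg a b
  exact ⟨q + r, fun s => by simp [hq, hr]⟩

theorem mul (hf : PolynomialOnLines K f) (hg : PolynomialOnLines K g) :
    PolynomialOnLines K (fun x => f x * g x) := by
  intro a b
  obtain ⟨q, hq⟩ := hf a b
  obtain ⟨r, hr⟩ := hg a b
  exact ⟨q * r, fun s => by simp [hq, hr]⟩

theorem sub (hf : PolynomialOnLines K f) (hg : PolynomialOnLines K g) :
    PolynomialOnLines K (fun x => f x - g x) := by
  intro a b
  obtain ⟨q, hq⟩ := hf a b
  obtain ⟨r, hr⟩ := hg a b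
  exact ⟨q - r, fun s => by simp [hq, hr]⟩

end PolynomialOnLines

theorem MultilinearMap.polynomialOnLines {K : Type*} [Field K] {ι : Type*} [Fintype ι]
    {V : Type*} [AddCommGroup V] [Module K V]
    (F : MultilinearMap K (fun _ : ι => V) K) : PolynomialOnLines K (fun x => F x) := by
  classical
  intro a b
  refine ⟨∑ s : Finset ι, C (F (s.piecewise b a)) * X ^ s.card, fun t => ?_⟩
  have h : F (a + t • b) = F (t • b + a) := by rw [add_comm]
  simp only [h, MultilinearMap.map_add_univ, eval_finsetSum, eval_mul, eval_C, eval_pow, eval_X]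
  refine Finset.sum_congr rfl fun s _ => ?_
  have e : s.piecewise (t • b) a =
      s.piecewise (fun i => t • s.piecewise b a i) (s.piecewise b a) := by
    ext i
    by_cases hi : i ∈ s <;> simp [hi]
  rw [e, MultilinearMap.map_piecewise_smul F (fun _ => t)]
  simp [mul_comm]

/-- Proportionality of two functions under changes of a single coordinate propagates to
arbitrary pairs of points. -/
theorem cross_mul_eq_of_update {K : Type*} [Field K] [Infinite K] {ι : Type*} [Fintype ι]
    [DecidableEq ι] {V : Type*} [AddCommGroup V] [Module K V] {f g : (ι → V) → K}
    (hf : PolynomialOnLines K f) (hg : PolynomialOnLines K g)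
    (h : ∀ x k v, f x * g (Function.update x k v) = f (Function.update x k v) * g x)
    (x y : ι → V) : f x * g y = f y * g x := by
  wlog hx : f x ≠ 0 generalizing f g
  · by_cases hgx : g x = 0
    · rw [not_not.mp hx, hgx]; ring
    · have := this hg hf (fun x k v => by rw [mul_comm, ← h, mul_comm]) hgx
      rw [mul_comm, ← this, mul_comm]
  suffices H : ∀ (S : Finset ι) (y : ι → V), (∀ k ∉ S, y k = x k) → f x * g y = f y * g x from
    H Finset.univ y (by simp)
  intro S
  induction S using Finset.induction_on with
  | empty =>
    intro y hy
    have : y = x := funext fun k => hy k (by simp)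
    rw [this]
  | insert k S hk ih =>
    intro y hy
    -- Along the line from `x` towards `y`, `q` is `f` with coordinate `k` frozen at `x k`, where
    -- induction applies, and `r` is the cross difference. Since `f` may vanish at the frozen
    -- endpoint, it is cancelled as a polynomial: `q ≠ 0` because `q(0) = f x`.
    obtain ⟨q, hq⟩ := hf x (Function.update (y - x) k 0)
    obtain ⟨r, hr⟩ := ((PolynomialOnLines.const (f x)).mul hg).sub
      (hf.mul (PolynomialOnLines.const (g x))) x (y - x)
    have hqr : q * r = 0 := by
      refine Polynomial.funext fun s => ?_
      rw [eval_mul, eval_zero, ← hq, ← hr]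
      have e : x + s • Function.update (y - x) k 0 = Function.update (x + s • (y - x)) k (x k) := by
        ext j
        by_cases hj : j = k
        · subst hj; simp
        · simp [hj]
      have h1 := ih (Function.update (x + s • (y - x)) k (x k)) (by
        intro j hj
        by_cases hjk : j = k
        · subst hjk; simp
        · simp [hjk, hy j (by simp [hj, hjk])])
      have h2 := h (x + s • (y - x)) k (x k)
      rw [e]
      linear_combination f (x + s • (y - x)) * h1 - f x * h2
    have hq0 : q ≠ 0 := by
      rintro rfl
      exact hx (by simpa using hq 0)
    have hr0 : r = 0 := (mul_eq_zero.mp hqr).resolve_left hq0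
    have := hr 1
    simp [hr0] at this
    linear_combination this

/-! ### Equivariant maps on matrix units: weight and parity -/

section Conjugation

variable {K : Type*} [Field K] {ι : Type*}

/-- A multilinear map of `2 × 2` matrices that commutes with simultaneous conjugation. -/
def ConjEquivariant
    (F : MultilinearMap K (fun _ : ι => Matrix (Fin 2) (Fin 2) K) (Matrix (Fin 2) (Fin 2) K)) :
    Prop :=
  ∀ g h : Matrix (Fin 2) (Fin 2) K, g * h = 1 → ∀ x, F (fun k => g * x k * h) = g * F x * h

/-- An entry of a matrix-valued multilinear map. -/
def MultilinearMap.entry (i j : Fin 2)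
    (F : MultilinearMap K (fun _ : ι => Matrix (Fin 2) (Fin 2) K) (Matrix (Fin 2) (Fin 2) K)) :
    MultilinearMap K (fun _ : ι => Matrix (Fin 2) (Fin 2) K) K :=
  (Matrix.entryLinearMap K K i j).compMultilinearMap F

@[simp]
theorem MultilinearMap.entry_apply (i j : Fin 2)
    (F : MultilinearMap K (fun _ : ι => Matrix (Fin 2) (Fin 2) K) (Matrix (Fin 2) (Fin 2) K))
    (x : ι → Matrix (Fin 2) (Fin 2) K) : F.entry i j x = F x i j := rfl

/-- The tuple of matrix units with rows `r` and columns `c`. -/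
def unitTuple (K : Type*) [Field K] {ι : Type*} (r c : ι → Fin 2) :
    ι → Matrix (Fin 2) (Fin 2) K :=
  fun k => Matrix.single (r k) (c k) 1

theorem exists_unitTuple_ne_zero [Finite ι]
    {F : MultilinearMap K (fun _ : ι => Matrix (Fin 2) (Fin 2) K) K}
    {x : ι → Matrix (Fin 2) (Fin 2) K} (hx : F x ≠ 0) : ∃ r c, F (unitTuple K r c) ≠ 0 := by
  by_contra! h
  have : F = 0 := Module.Basis.ext_multilinear
    (fun _ => Matrix.stdBasis K (Fin 2) (Fin 2)) fun v => by
      have e : ∀ k, Matrix.stdBasis K (Fin 2) (Fin 2) (v k) = Matrix.single (v k).1 (v k).2 1 :=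
        fun k => Matrix.stdBasis_eq_single _ _ _
      simp only [e]
      exact h (fun k => (v k).1) (fun k => (v k).2)
  exact hx (by simp [this])

theorem swap_conj_apply (A : Matrix (Fin 2) (Fin 2) K) (i j : Fin 2) :
    (!![0, 1; 1, 0] * A * !![0, 1; 1, 0] : Matrix (Fin 2) (Fin 2) K) i j = A (i + 1) (j + 1) := by
  rw [A.eta_fin_two]
  fin_cases i <;> fin_cases j <;> simp

theorem ConjEquivariant.swap {F : MultilinearMap K (fun _ : ι => Matrix (Fin 2) (Fin 2) K)
    (Matrix (Fin 2) (Fin 2) K)} (hF : ConjEquivariant F) (r c : ι → Fin 2) (i j : Fin 2) :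
    F (unitTuple K (fun k => r k + 1) (fun k => c k + 1)) i j =
      F (unitTuple K r c) (i + 1) (j + 1) := by
  have hw : (!![0, 1; 1, 0] : Matrix (Fin 2) (Fin 2) K) * !![0, 1; 1, 0] = 1 := by
    simp [Matrix.one_fin_two]
  have e : (fun k => !![0, 1; 1, 0] * unitTuple K r c k * !![0, 1; 1, 0]) =
      unitTuple K (fun k => r k + 1) (fun k => c k + 1) := by
    ext k a b
    simp only [unitTuple, swap_conj_apply, Matrix.single_apply]
    generalize r k = p
    generalize c k = q
    have : (p = a + 1 ∧ q = b + 1) ↔ (p + 1 = a ∧ q + 1 = b) := by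
      revert a b p q
      decide
    simp only [this]
  rw [← e, hF _ _ hw (unitTuple K r c), swap_conj_apply]

variable [Fintype ι]
  {F : MultilinearMap K (fun _ : ι => Matrix (Fin 2) (Fin 2) K) (Matrix (Fin 2) (Fin 2) K)}

/-- Conjugation by diag(t, 1) scales each matrix unit by a power of `t`; comparing powers on the two
sides for all nonzero `t` equates the exponents. -/
theorem ConjEquivariant.weight [Infinite K] (hF : ConjEquivariant F) {r c : ι → Fin 2}
    {i j : Fin 2} (h : F (unitTuple K r c) i j ≠ 0) :
    (∑ k, if r k = 0 then 1 else 0) + (if j = 0 then 1 else 0) =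
      (∑ k, if c k = 0 then 1 else 0) + (if i = 0 then 1 else 0) := by
  set A := (∑ k, if r k = 0 then 1 else 0) + (if j = 0 then 1 else 0) with hA
  set B := (∑ k, if c k = 0 then 1 else 0) + (if i = 0 then 1 else 0) with hB
  have key : ∀ t : K, t ≠ 0 → t ^ A = t ^ B := by
    intro t ht
    set d : Fin 2 → K := fun l => t ^ (if l = 0 then 1 else 0) with hd
    have hd0 : ∀ l, d l ≠ 0 := fun l => pow_ne_zero _ ht
    have hgh : Matrix.diagonal d * Matrix.diagonal (fun l => (d l)⁻¹) = 1 := by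
      rw [Matrix.diagonal_mul_diagonal, ← Matrix.diagonal_one]
      congr 1
      ext l
      exact mul_inv_cancel₀ (hd0 l)
    have h1 := hF _ _ hgh (unitTuple K r c)
    have h2 : (fun k => Matrix.diagonal d * unitTuple K r c k *
        Matrix.diagonal (fun l => (d l)⁻¹)) =
        fun k => (d (r k) * (d (c k))⁻¹) • unitTuple K r c k := by
      ext k a b
      simp only [Matrix.mul_diagonal, Matrix.diagonal_mul, unitTuple, Matrix.smul_apply,
        Matrix.single_apply, smul_eq_mul]
      split_ifs with hab
      · rw [hab.1, hab.2]; ring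
      · ring
    rw [h2, MultilinearMap.map_smul_univ] at h1
    have h3 := congrFun (congrFun h1 i) j
    simp only [Matrix.mul_diagonal, Matrix.diagonal_mul, Matrix.smul_apply, smul_eq_mul] at h3
    have h4 : (∏ k, d (r k) * (d (c k))⁻¹) = d i * (d j)⁻¹ :=
      mul_right_cancel₀ h (by rw [h3]; ring)
    rw [Finset.prod_mul_distrib, Finset.prod_inv_distrib, ← div_eq_mul_inv, ← div_eq_mul_inv,
      div_eq_div_iff (Finset.prod_ne_zero_iff.mpr fun k _ => hd0 _) (hd0 j)] at h4
    simp only [hd, Finset.prod_pow_eq_pow_sum] at h4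
    rw [hA, hB, pow_add, pow_add, h4, mul_comm]
  -- The extra factor `X` makes both sides vanish at 0, where `key` says nothing.
  have hX : (X : K[X]) ^ (A + 1) = X ^ (B + 1) := by
    refine Polynomial.funext fun t => ?_
    by_cases ht : t = 0
    · simp [ht]
    · simp [pow_succ, key t ht]
  have := congrArg natDegree hX
  simpa using this

theorem ConjEquivariant.parity [Infinite K] (hF : ConjEquivariant F) {r c : ι → Fin 2}
    {i j : Fin 2} (h : F (unitTuple K r c) i j ≠ 0) :
    (∑ k, ((if r k = 0 then 1 else 0) + (if c k = 0 then 1 else 0))) % 2 =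
      if i = j then 0 else 1 := by
  have := hF.weight h
  rw [Finset.sum_add_distrib]
  fin_cases i <;> fin_cases j <;> simp at this ⊢ <;> omega

/-- The parity survives swapping both indices of any single argument, not only of all arguments at
once. -/
theorem parity_add (r c v : ι → Fin 2) :
    (∑ k, ((if r k + v k = 0 then 1 else 0) + (if c k + v k = 0 then 1 else 0))) % 2 =
      (∑ k, ((if r k = 0 then 1 else 0) + (if c k = 0 then 1 else 0))) % 2 := by
  rw [Finset.sum_nat_mod,
    Finset.sum_nat_mod (f := fun k => (if r k = 0 then 1 else 0) + (if c k = 0 then 1 else 0))]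
  congr 1
  refine Finset.sum_congr rfl fun k _ => ?_
  generalize r k = a
  generalize c k = b
  generalize v k = w
  revert a b w
  decide

end Conjugation

/-! ### Conjugacy classes of nonscalar 2×2 matrices -/

section Classification

variable {K : Type*} [Field K]

theorem mem_scalarMatrices_iff {A : Matrix (Fin 2) (Fin 2) K} :
    A ∈ scalarMatrices 2 K ↔ A 0 1 = 0 ∧ A 1 0 = 0 ∧ A 0 0 = A 1 1 := by
  constructor
  · rintro ⟨c, rfl⟩
    simp
  · rintro ⟨h1, h2, h3⟩
    refine ⟨A 0 0, ?_⟩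
    ext i j
    fin_cases i <;> fin_cases j <;> simp [h1, h2, h3]

/-- A nonscalar `2 × 2` matrix is conjugate to the companion matrix of its characteristic
polynomial. -/
theorem exists_conj_companion {A : Matrix (Fin 2) (Fin 2) K} (hA : A ∉ scalarMatrices 2 K) :
    ∃ M N : Matrix (Fin 2) (Fin 2) K, M * N = 1 ∧ A = M * !![0, -A.det; 1, A.trace] * N := by
  suffices h : ∃ M : Matrix (Fin 2) (Fin 2) K, M.det ≠ 0 ∧ A * M = M * !![0, -A.det; 1, A.trace] by
    obtain ⟨M, hM, h⟩ := h
    have hu : IsUnit M.det := isUnit_iff_ne_zero.mpr hM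
    refine ⟨M, M⁻¹, Matrix.mul_nonsing_inv M hu, ?_⟩
    rw [← h, Matrix.mul_nonsing_inv_cancel_right _ _ hu]
  rw [mem_scalarMatrices_iff] at hA
  -- In each case the columns of the witness are `v` and `A v` for a cyclic vector `v`: (1, 1), (0,
  -- 1) or (1, 0).
  by_cases h1 : A 1 0 = 0
  · by_cases h2 : A 0 1 = 0
    · have h3 : A 0 0 ≠ A 1 1 := fun h => hA ⟨h2, h1, h⟩
      refine ⟨!![1, A 0 0; 1, A 1 1], ?_, ?_⟩
      · rw [Matrix.det_fin_two_of]
        intro h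
        exact h3 (by linear_combination -h)
      · ext i j
        fin_cases i <;> fin_cases j <;>
          simp [Matrix.mul_apply, Fin.sum_univ_two, Matrix.det_fin_two, Matrix.trace_fin_two, h1,
            h2] <;> ring
    · refine ⟨!![0, A 0 1; 1, A 1 1], by simpa [Matrix.det_fin_two_of] using h2, ?_⟩
      ext i j
      fin_cases i <;> fin_cases j <;>
        simp [Matrix.mul_apply, Fin.sum_univ_two, Matrix.det_fin_two, Matrix.trace_fin_two] <;>
        ring
  · refine ⟨!![1, A 0 0; 0, A 1 0], by simpa [Matrix.det_fin_two_of] using h1, ?_⟩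
    ext i j
    fin_cases i <;> fin_cases j <;>
      simp [Matrix.mul_apply, Fin.sum_univ_two, Matrix.det_fin_two, Matrix.trace_fin_two] <;>
      ring

/-- A set of matrices that is stable under conjugation and scalar multiplication. -/
structure IsConjCone (S : Set (Matrix (Fin 2) (Fin 2) K)) : Prop where
  conj_mem : ∀ g h A, g * h = 1 → A ∈ S → g * A * h ∈ S
  smul_mem : ∀ (c : K) (A), A ∈ S → c • A ∈ S

variable {S : Set (Matrix (Fin 2) (Fin 2) K)} {A B : Matrix (Fin 2) (Fin 2) K}

theorem IsConjCone.mem_of_trace_det (hS : IsConjCone S) (hA : A ∈ S)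
    (hA' : A ∉ scalarMatrices 2 K) (hB : B ∉ scalarMatrices 2 K) (ht : B.trace = A.trace)
    (hd : B.det = A.det) : B ∈ S := by
  obtain ⟨M, N, hMN, h⟩ := exists_conj_companion hA'
  obtain ⟨M', N', hMN', h'⟩ := exists_conj_companion hB
  rw [h', ht, hd]
  refine hS.conj_mem _ _ _ hMN' ?_
  have hNM : N * M = 1 := mul_eq_one_comm.mp hMN
  have e : N * A * M = !![0, -A.det; 1, A.trace] := by
    conv_lhs => rw [h]
    calc _ = (N * M) * !![0, -A.det; 1, A.trace] * (N * M) := by simp only [Matrix.mul_assoc]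
      _ = _ := by rw [hNM, one_mul, mul_one]
  rw [← e]
  exact hS.conj_mem _ _ _ hNM hA

theorem smul_notMem_scalarMatrices {c : K} (hc : c ≠ 0) (hA : A ∉ scalarMatrices 2 K) :
    c • A ∉ scalarMatrices 2 K := by
  rw [mem_scalarMatrices_iff] at hA ⊢
  simpa [hc] using hA

theorem IsConjCone.mem_of_smul_trace_det (hS : IsConjCone S) (hA : A ∈ S)
    (hA' : A ∉ scalarMatrices 2 K) (hB : B ∉ scalarMatrices 2 K) {c : K} (hc : c ≠ 0)
    (ht : B.trace = c * A.trace) (hd : B.det = c ^ 2 * A.det) : B ∈ S :=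
  hS.mem_of_trace_det (hS.smul_mem c A hA) (smul_notMem_scalarMatrices hc hA') hB
    (by simp [ht]) (by simp [hd])

end Classification

/-! ### Diagonal and nilpotent values -/

section UnitValues

variable {K : Type*} [Field K] {ι : Type*}
  {F : MultilinearMap K (fun _ : ι => Matrix (Fin 2) (Fin 2) K) (Matrix (Fin 2) (Fin 2) K)}

variable [Fintype ι] [Infinite K]

theorem ConjEquivariant.offDiag_eq_zero (hF : ConjEquivariant F) {r c : ι → Fin 2} {i : Fin 2}
    (h : F (unitTuple K r c) i i ≠ 0) :
    F (unitTuple K r c) 0 1 = 0 ∧ F (unitTuple K r c) 1 0 = 0 := by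
  have h1 := hF.parity h
  constructor <;> by_contra h2 <;> have h3 := hF.parity h2 <;> simp_all

/-- A strictly upper triangular value on a tuple of matrix units. -/
theorem ConjEquivariant.exists_strictUpper (hF : ConjEquivariant F)
    (hns : ∃ x, F x ∉ scalarMatrices 2 K) :
    ∃ r c : ι → Fin 2, ∃ n : K, n ≠ 0 ∧ F (unitTuple K r c) = !![0, n; 0, 0] := by
  have h01 : ∃ x, F.entry 0 1 x ≠ 0 := by
    by_contra! h
    obtain ⟨x, hx⟩ := hns
    have h01 : F x 0 1 = 0 := h x
    have h10 : F x 1 0 = 0 := by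
      have hw : (!![0, 1; 1, 0] : Matrix (Fin 2) (Fin 2) K) * !![0, 1; 1, 0] = 1 := by
        simp [Matrix.one_fin_two]
      have := h (fun k => !![0, 1; 1, 0] * x k * !![0, 1; 1, 0])
      rw [MultilinearMap.entry_apply, hF _ _ hw, swap_conj_apply] at this
      exact this
    refine hx (mem_scalarMatrices_iff.mpr ⟨h01, h10, ?_⟩)
    -- This conjugation puts the difference of the diagonal entries in position (0, 1).
    have hw : (!![1, 1; 0, 1] : Matrix (Fin 2) (Fin 2) K) * !![1, -1; 0, 1] = 1 := by
      simp [Matrix.one_fin_two]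
    have h1 := h (fun k => !![1, 1; 0, 1] * x k * !![1, -1; 0, 1])
    rw [MultilinearMap.entry_apply, hF _ _ hw, (F x).eta_fin_two] at h1
    simp [h01, h10] at h1
    linear_combination -h1
  obtain ⟨x, hx⟩ := h01
  obtain ⟨r, c, h⟩ := exists_unitTuple_ne_zero hx
  rw [MultilinearMap.entry_apply] at h
  refine ⟨r, c, _, h, ?_⟩
  have hw := hF.weight h
  ext i j
  by_contra hij
  have := hF.weight (r := r) (c := c) (i := i) (j := j) (by
    fin_cases i <;> fin_cases j <;> simp_all)
  fin_cases i <;> fin_cases j <;> simp at this hw hij <;> omega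

/-- A value all of whose entries are nonzero, conjugate to a strictly upper triangular one. -/
theorem ConjEquivariant.exists_nilpotent_full (hF : ConjEquivariant F)
    (hns : ∃ x, F x ∉ scalarMatrices 2 K) :
    ∃ x, ∃ n : K, n ≠ 0 ∧ F x = !![-n, n; -n, n] := by
  obtain ⟨r, c, n, hn, h⟩ := hF.exists_strictUpper hns
  -- The result has nonzero (0, 0) entry and diagonal difference `-2n`, so these functionals can be
  -- detected on matrix units.
  have hw : (!![1, 0; 1, 1] : Matrix (Fin 2) (Fin 2) K) * !![1, 0; -1, 1] = 1 := by
    simp [Matrix.one_fin_two]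
  exact ⟨_, n, hn, by rw [hF _ _ hw, h]; simp⟩

end UnitValues

/-! ### Pencils in the range, and the traceless case -/

section Range

variable {K : Type*} [Field K] {ι : Type*} [DecidableEq ι]
  {F : MultilinearMap K (fun _ : ι => Matrix (Fin 2) (Fin 2) K) (Matrix (Fin 2) (Fin 2) K)}

theorem MultilinearMap.add_smul_mem_range {V W : Type*} [AddCommGroup V] [Module K V]
    [AddCommGroup W] [Module K W] (G : MultilinearMap K (fun _ : ι => V) W) (x : ι → V) (k : ι)
    (v : V) (a b : K) : a • G x + b • G (Function.update x k v) ∈ Set.range G := by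
  refine ⟨Function.update x k (a • x k + b • v), ?_⟩
  rw [G.map_update_add, G.map_update_smul, G.map_update_smul, Function.update_eq_self]

theorem ConjEquivariant.isConjCone [Nonempty ι] (hF : ConjEquivariant F) :
    IsConjCone (Set.range F) where
  conj_mem := by
    rintro g h _ hgh ⟨x, rfl⟩
    exact ⟨_, hF g h hgh x⟩
  smul_mem := by
    rintro c _ ⟨x, rfl⟩
    simpa using F.add_smul_mem_range x (Classical.arbitrary ι) 0 c 0

variable [Fintype ι] [Infinite K]

/-- Swapping all indices turns a value `n E₀₁` into `n E₁₀`, so the two off-diagonal entries are not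
proportional globally. -/
theorem ConjEquivariant.exists_update_offDiag_cross_ne (hF : ConjEquivariant F)
    (hns : ∃ x, F x ∉ scalarMatrices 2 K) :
    ∃ x k v, F x 0 1 * F (Function.update x k v) 1 0 ≠ F (Function.update x k v) 0 1 * F x 1 0 := by
  by_contra! h
  obtain ⟨r, c, n, hn, hu⟩ := hF.exists_strictUpper hns
  have := cross_mul_eq_of_update (F.entry 0 1).polynomialOnLines (F.entry 1 0).polynomialOnLines h
    (unitTuple K r c) (unitTuple K (fun k => r k + 1) (fun k => c k + 1))
  simp [hF.swap, hu, hn] at this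

/-- A nonscalar equivariant multilinear map with traceless values takes every traceless value. -/
theorem ConjEquivariant.range_eq_slMatrices [Nonempty ι] (hF : ConjEquivariant F)
    (hsq : ∀ a : K, ∃ s, s ^ 2 = a) (hns : ∃ x, F x ∉ scalarMatrices 2 K)
    (htr : ∀ x, (F x).trace = 0) : Set.range F = slMatrices 2 K := by
  have hS := hF.isConjCone
  refine Set.Subset.antisymm (by rintro _ ⟨x, rfl⟩; exact htr x) fun A hA => ?_
  have hA0 : A.trace = 0 := hA
  -- In characteristic 2 nonzero scalars are traceless too; they are multiples of a diagonal value
  -- diag(a, -a).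
  by_cases hsc : A ∈ scalarMatrices 2 K
  · obtain ⟨h1, h2, h3⟩ := mem_scalarMatrices_iff.mp hsc
    obtain ⟨y, n, hn, hy⟩ := hF.exists_nilpotent_full hns
    obtain ⟨r, c, hu⟩ := exists_unitTuple_ne_zero (F := F.entry 0 0) (x := y) (by simp [hy, hn])
    rw [MultilinearMap.entry_apply] at hu
    obtain ⟨h01, h10⟩ := hF.offDiag_eq_zero hu
    have ht := htr (unitTuple K r c)
    rw [Matrix.trace_fin_two] at ht hA0
    convert hS.smul_mem (A 0 0 / F (unitTuple K r c) 0 0) _ ⟨unitTuple K r c, rfl⟩ using 1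
    have e : A 1 1 * F (unitTuple K r c) 0 0 = A 0 0 * F (unitTuple K r c) 1 1 := by
      linear_combination F (unitTuple K r c) 0 0 * hA0 - A 0 0 * ht
    ext i j
    fin_cases i <;> fin_cases j <;> simp [h1, h2, h01, h10, hu]
    field_simp
    linear_combination e
  by_cases hd : A.det = 0
  · obtain ⟨r, c, n, hn, h⟩ := hF.exists_strictUpper hns
    refine hS.mem_of_trace_det ⟨unitTuple K r c, h⟩ ?_ hsc (by simp [hA0, Matrix.trace_fin_two])
      (by simp [hd])
    simp [mem_scalarMatrices_iff, hn]
  · obtain ⟨x, k, v, hne⟩ := hF.exists_update_offDiag_cross_ne hns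
    set B := F x
    set C := F (Function.update x k v)
    have hB : B.trace = 0 := htr _
    have hC : C.trace = 0 := htr _
    have hmem : ∀ a b : K, a • B + b • C ∈ Set.range F := F.add_smul_mem_range x k v
    have hnsc : ∀ a b : K, (a ≠ 0 ∨ b ≠ 0) → a • B + b • C ∉ scalarMatrices 2 K := by
      intro a b hab h
      rw [mem_scalarMatrices_iff] at h
      simp at h
      obtain ⟨h1, h2, -⟩ := h
      rcases hab with ha | hb
      · exact hne (mul_left_cancel₀ ha (by linear_combination C 1 0 * h1 - C 0 1 * h2))
      · exact hne (mul_left_cancel₀ hb (by linear_combination B 0 1 * h2 - B 1 0 * h1))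
    suffices h : ∃ a b : K, (a ≠ 0 ∨ b ≠ 0) ∧ (a • B + b • C).det ≠ 0 by
      obtain ⟨a, b, hab, hD⟩ := h
      obtain ⟨s, hs⟩ := hsq (A.det / (a • B + b • C).det)
      refine hS.mem_of_smul_trace_det (hmem a b) (hnsc a b hab) hsc (c := s) ?_ ?_ ?_
      · rintro rfl
        have : A.det / (a • B + b • C).det ≠ 0 := div_ne_zero hd hD
        exact this (by rw [← hs]; ring)
      · simp [hA0, hB, hC]
      · rw [hs, div_mul_cancel₀ _ hD]
    -- For traceless `B`, `C`, singularity of `B`, `C` and `B + C` forces the square of the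
    -- off-diagonal cross difference to vanish.
    by_contra! h
    have e1 := h 1 0 (by simp)
    have e2 := h 0 1 (by simp)
    have e3 := h 1 1 (by simp)
    rw [Matrix.trace_fin_two] at hB hC
    simp only [Matrix.det_fin_two, Matrix.add_apply, Matrix.smul_apply, smul_eq_mul] at e1 e2 e3
    have hB' : B 1 1 = -B 0 0 := by linear_combination hB
    have hC' : C 1 1 = -C 0 0 := by linear_combination hC
    rw [hB', hC'] at e3
    rw [hB'] at e1
    rw [hC'] at e2
    have f1 : B 0 0 ^ 2 = -(B 0 1 * B 1 0) := by linear_combination -e1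
    have f2 : C 0 0 ^ 2 = -(C 0 1 * C 1 0) := by linear_combination -e2
    have f3 : B 0 1 * C 1 0 + C 0 1 * B 1 0 = -(2 * B 0 0 * C 0 0) := by
      linear_combination e1 + e2 - e3
    have : (B 0 1 * C 1 0 - C 0 1 * B 1 0) ^ 2 = 0 := by
      linear_combination (B 0 1 * C 1 0 + C 0 1 * B 1 0 - 2 * B 0 0 * C 0 0) * f3 +
        4 * C 0 0 ^ 2 * f1 - 4 * (B 0 1 * B 1 0) * f2
    exact hne (sub_eq_zero.mp (pow_eq_zero_iff two_ne_zero |>.mp this))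

end Range

/-! ### Diagonal values when some trace is nonzero -/

section Diagonal

variable {K : Type*} [Field K] {ι : Type*}
  {F : MultilinearMap K (fun _ : ι => Matrix (Fin 2) (Fin 2) K) (Matrix (Fin 2) (Fin 2) K)}

/-- The linear map onto the span of a matrix unit and its image under swapping both indices. -/
def swapSpan (K : Type*) [Field K] (i j : Fin 2) : (Fin 2 → K) →ₗ[K] Matrix (Fin 2) (Fin 2) K :=
  Fintype.linearCombination K fun l => Matrix.single (i + l) (j + l) 1

theorem swapSpan_single (i j l : Fin 2) :
    swapSpan K i j (Pi.single l 1) = Matrix.single (i + l) (j + l) 1 := by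
  simp [swapSpan, Fintype.linearCombination_apply_single]

/-- The discriminant of the characteristic polynomial of a `2 × 2` matrix. -/
def charDiscr (A : Matrix (Fin 2) (Fin 2) K) : K := (A 0 0 - A 1 1) ^ 2 + 4 * (A 0 1 * A 1 0)

theorem charDiscr_eq (A : Matrix (Fin 2) (Fin 2) K) : charDiscr A = A.trace ^ 2 - 4 * A.det := by
  rw [charDiscr, Matrix.trace_fin_two, Matrix.det_fin_two]
  ring

/-- In a pencil along which `tr² : discr` is not constant, every ratio other than `0` and `∞` is
attained. -/
theorem exists_pencil_ratio (hq : ∀ a b c : K, (a ≠ 0 ∨ b ≠ 0) → ∃ s, a * s ^ 2 + b * s + c = 0)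
    (h2 : (2 : K) ≠ 0) {B C : Matrix (Fin 2) (Fin 2) K}
    (h : B.trace ^ 2 * charDiscr C ≠ C.trace ^ 2 * charDiscr B) (u : K) {v : K} (hv : v ≠ 0) :
    ∃ a b : K, (a • B + b • C).trace ≠ 0 ∧
      u * (a • B + b • C).trace ^ 2 = v * charDiscr (a • B + b • C) := by
  wlog hB : B.trace ≠ 0 generalizing B C
  · have hC : C.trace ≠ 0 := by
      intro hC
      rw [not_not] at hB
      exact h (by rw [hB, hC]; ring)
    obtain ⟨a, b, hab⟩ := this h.symm hC
    exact ⟨b, a, by rwa [add_comm]⟩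
  -- `D` is traceless, so the trace is constant along `B + s • D` and the required ratio becomes a
  -- quadratic equation in `s`; `2 * e` is the linear coefficient of the discriminant.
  set D := B.trace • C - C.trace • B with hD
  set e := (D 0 0 - D 1 1) * (B 0 0 - B 1 1) + 2 * (D 0 1 * B 1 0 + D 1 0 * B 0 1) with he
  obtain ⟨s, hs⟩ := hq (v * charDiscr D) (v * (2 * e)) (v * charDiscr B - u * B.trace ^ 2) (by
    by_contra! h0
    have h1 := (mul_eq_zero.mp h0.1).resolve_left hv
    have h3 := (mul_eq_zero.mp ((mul_eq_zero.mp h0.2).resolve_left hv)).resolve_left h2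
    refine h ?_
    have : charDiscr D + 2 * C.trace * e =
        B.trace ^ 2 * charDiscr C - C.trace ^ 2 * charDiscr B := by
      simp only [he, hD, charDiscr, Matrix.sub_apply, Matrix.smul_apply, smul_eq_mul]
      ring
    rw [h1, h3] at this
    linear_combination -this)
  refine ⟨1 - s * C.trace, s * B.trace, ?_⟩
  have hE : (1 - s * C.trace) • B + (s * B.trace) • C = B + s • D := by
    rw [hD]
    module
  have ht : (B + s • D).trace = B.trace := by
    rw [hD, Matrix.trace_add, Matrix.trace_smul, Matrix.trace_sub, Matrix.trace_smul,
      Matrix.trace_smul]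
    simp only [smul_eq_mul]
    ring
  rw [hE, ht]
  refine ⟨hB, ?_⟩
  have : charDiscr (B + s • D) = charDiscr D * s ^ 2 + 2 * e * s + charDiscr B := by
    simp only [he, charDiscr, Matrix.add_apply, Matrix.smul_apply, smul_eq_mul]
    ring
  rw [this]
  linear_combination -hs

variable [DecidableEq ι] [Fintype ι] [Infinite K]

/-- Let each argument range over the span of its unit and the swapped unit. Parity keeps all values
diagonal, and swapping everything turns diag(a, b) into diag(b, a), which is not proportional since
a² ≠ b². Some one-coordinate step then gives two independent diagonal values. -/
theorem ConjEquivariant.diagonal_mem_of_sq_ne (hF : ConjEquivariant F) {r c : ι → Fin 2}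
    (h : F (unitTuple K r c) 0 0 ^ 2 ≠ F (unitTuple K r c) 1 1 ^ 2) (d : Fin 2 → K) :
    Matrix.diagonal d ∈ Set.range F := by
  have hne : ∃ i, F (unitTuple K r c) i i ≠ 0 := by
    by_contra! h0
    exact h (by rw [h0, h0])
  obtain ⟨i₀, hi₀⟩ := hne
  set G := F.compLinearMap (fun k => swapSpan K (r k) (c k)) with hG
  have hGs : ∀ l : ι → Fin 2, G (fun k => Pi.single (l k) 1) =
      F (unitTuple K (fun k => r k + l k) (fun k => c k + l k)) := fun l => by
    simp only [hG, MultilinearMap.compLinearMap_apply, swapSpan_single]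
    rfl
  have hoff : ∀ i j, i ≠ j → ∀ x, G x i j = 0 := by
    intro i j hij x
    have : (Matrix.entryLinearMap K K i j).compMultilinearMap G = 0 :=
      Module.Basis.ext_multilinear (fun _ => Pi.basisFun K (Fin 2)) fun l => by
        simp only [Pi.basisFun_apply, LinearMap.compMultilinearMap_apply, hGs,
          Matrix.entryLinearMap_apply, zero_apply]
        by_contra h0
        have h1 := hF.parity h0
        rw [parity_add, hF.parity hi₀] at h1
        simp [hij] at h1
    exact congrArg (fun Q => Q x) this
  have hstep : ∃ x k v, G x 0 0 * G (Function.update x k v) 1 1 ≠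
      G (Function.update x k v) 0 0 * G x 1 1 := by
    by_contra! hall
    have := cross_mul_eq_of_update
      ((Matrix.entryLinearMap K K 0 0).compMultilinearMap G).polynomialOnLines
      ((Matrix.entryLinearMap K K 1 1).compMultilinearMap G).polynomialOnLines hall
      (fun _ => Pi.single 0 1) (fun _ => Pi.single 1 1)
    have e0 := hGs (fun _ => 0)
    have e1 := hGs (fun _ => 1)
    simp only [add_zero] at e0
    simp only [LinearMap.compMultilinearMap_apply, Matrix.entryLinearMap_apply, e0, e1,
      hF.swap] at this
    exact h (by simpa [sq] using this)
  obtain ⟨x, k, v, hne⟩ := hstep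
  have hmem := G.add_smul_mem_range x k v
  have hB := fun i j hij => hoff i j hij x
  have hC := fun i j hij => hoff i j hij (Function.update x k v)
  generalize G x = B at *
  generalize G (Function.update x k v) = C at *
  obtain ⟨δ, hδ⟩ : ∃ δ, δ = B 0 0 * C 1 1 - C 0 0 * B 1 1 := ⟨_, rfl⟩
  have hδ0 : δ ≠ 0 := hδ ▸ sub_ne_zero.mpr hne
  -- Cramer's rule for `d` in terms of the two diagonals.
  obtain ⟨y, hy⟩ := hmem ((d 0 * C 1 1 - d 1 * C 0 0) / δ) ((d 1 * B 0 0 - d 0 * B 1 1) / δ)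
  refine ⟨_, Eq.trans hy ?_⟩
  ext i j
  fin_cases i <;> fin_cases j <;> simp [hB, hC]
  · field_simp
    rw [hδ]
    ring
  · field_simp
    rw [hδ]
    ring

/-- The values at `x` and `y` show that tr² : discr is not constant, hence not constant on some
pencil, and `exists_pencil_ratio` reaches the ratio of `Matrix.diagonal d`. -/
theorem ConjEquivariant.diagonal_mem_of_discr [Nonempty ι] (hF : ConjEquivariant F)
    (hq : ∀ a b c : K, (a ≠ 0 ∨ b ≠ 0) → ∃ s, a * s ^ 2 + b * s + c = 0) (h2 : (2 : K) ≠ 0)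
    {x y : ι → Matrix (Fin 2) (Fin 2) K} (hx : (F x).trace ≠ 0) (hx' : charDiscr (F x) = 0)
    (hy : charDiscr (F y) ≠ 0) {d : Fin 2 → K} (hd : d 0 ≠ d 1)
    (hd' : d 0 + d 1 ≠ 0) : Matrix.diagonal d ∈ Set.range F := by
  have htrace : ∀ z, (F z).trace = F z 0 0 + F z 1 1 := fun z => Matrix.trace_fin_two _
  have hstep : ∃ x k v, (F x).trace ^ 2 * charDiscr (F (Function.update x k v)) ≠
      (F (Function.update x k v)).trace ^ 2 * charDiscr (F x) := by
    by_contra! hall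
    have e := fun i j => (F.entry i j).polynomialOnLines
    have p1 : PolynomialOnLines K fun z => (F z).trace ^ 2 := by
      simp only [htrace, sq]
      exact ((e 0 0).add (e 1 1)).mul ((e 0 0).add (e 1 1))
    have p2 : PolynomialOnLines K fun z => charDiscr (F z) := by
      simp only [charDiscr, sq]
      exact (((e 0 0).sub (e 1 1)).mul ((e 0 0).sub (e 1 1))).add
        ((PolynomialOnLines.const 4).mul ((e 0 1).mul (e 1 0)))
    have := cross_mul_eq_of_update p1 p2 hall x y
    rw [hx', mul_zero] at this
    exact mul_ne_zero (pow_ne_zero 2 hx) hy this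
  obtain ⟨z, k, v, hne⟩ := hstep
  obtain ⟨a, b, ht, he⟩ := exists_pencil_ratio hq h2 hne ((d 0 - d 1) ^ 2)
    (v := (d 0 + d 1) ^ 2) (pow_ne_zero 2 hd')
  have hmem := F.add_smul_mem_range z k v a b
  generalize a • F z + b • F (Function.update z k v) = A at *
  have hdisc : charDiscr A ≠ 0 := by
    intro h0
    rw [h0, mul_zero] at he
    exact mul_ne_zero (pow_ne_zero 2 (sub_ne_zero.mpr hd)) (pow_ne_zero 2 ht) he
  refine hF.isConjCone.mem_of_smul_trace_det hmem ?_ ?_ (c := (d 0 + d 1) / A.trace)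
    (div_ne_zero hd' ht) ?_ ?_
  · rw [mem_scalarMatrices_iff]
    rintro ⟨h01, h10, h00⟩
    exact hdisc (by simp [charDiscr, h01, h00])
  · simpa [mem_scalarMatrices_iff] using hd
  · rw [div_mul_cancel₀ _ ht]
    simp
  · rw [charDiscr_eq] at he
    have h4 : (4 : K) ≠ 0 := by
      rw [show (4 : K) = 2 * 2 by norm_num]
      exact mul_ne_zero h2 h2
    simp only [Matrix.det_diagonal, Fin.prod_univ_two]
    field_simp
    refine mul_left_cancel₀ h4 ?_
    linear_combination -he

/-- If an equivariant multilinear map has a nonscalar value and a value with nonzero trace, then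
it takes every diagonal value. -/
theorem ConjEquivariant.diagonal_mem [Nonempty ι] (hF : ConjEquivariant F)
    (hq : ∀ a b c : K, (a ≠ 0 ∨ b ≠ 0) → ∃ s, a * s ^ 2 + b * s + c = 0)
    (hns : ∃ x, F x ∉ scalarMatrices 2 K) (htr : ∃ x, (F x).trace ≠ 0) (d : Fin 2 → K) :
    Matrix.diagonal d ∈ Set.range F := by
  by_cases hex : ∃ r c : ι → Fin 2, F (unitTuple K r c) 0 0 ^ 2 ≠ F (unitTuple K r c) 1 1 ^ 2
  · obtain ⟨r, c, h⟩ := hex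
    exact hF.diagonal_mem_of_sq_ne h d
  push Not at hex
  obtain ⟨x, hx⟩ := htr
  obtain ⟨r, c, hu⟩ := exists_unitTuple_ne_zero (F := F.entry 0 0 + F.entry 1 1) (x := x)
    (by simpa [Matrix.trace_fin_two] using hx)
  simp only [add_apply, MultilinearMap.entry_apply] at hu
  -- Equal squares and nonzero sum force a value diag(a, a) with 2a ≠ 0, so the characteristic is
  -- not 2; the second tuple below gives diag(a', -a').
  have hab : F (unitTuple K r c) 1 1 = F (unitTuple K r c) 0 0 :=
    mul_left_cancel₀ hu (by linear_combination -hex r c)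
  rw [hab, ← two_mul] at hu
  have h2 : (2 : K) ≠ 0 := left_ne_zero_of_mul hu
  have ha := right_ne_zero_of_mul hu
  obtain ⟨h01, h10⟩ := hF.offDiag_eq_zero ha
  obtain ⟨y, n, hn, hy⟩ := hF.exists_nilpotent_full hns
  obtain ⟨r', c', hu'⟩ := exists_unitTuple_ne_zero (F := F.entry 0 0 - F.entry 1 1) (x := y) (by
    simp only [sub_apply, MultilinearMap.entry_apply, hy]
    simpa [← neg_add', ← two_mul, hn] using h2)
  simp only [sub_apply, MultilinearMap.entry_apply] at hu'
  have hab' : F (unitTuple K r' c') 1 1 = -F (unitTuple K r' c') 0 0 :=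
    mul_left_cancel₀ hu' (by linear_combination hex r' c')
  rw [hab', sub_neg_eq_add, ← two_mul] at hu'
  have ha' := right_ne_zero_of_mul hu'
  obtain ⟨h01', h10'⟩ := hF.offDiag_eq_zero ha'
  by_cases hd : d 0 = d 1
  · convert hF.isConjCone.smul_mem (d 0 / F (unitTuple K r c) 0 0) _
      ⟨unitTuple K r c, rfl⟩ using 1
    ext i j
    fin_cases i <;> fin_cases j <;> simp [h01, h10, hab, ha, hd]
  by_cases hd' : d 0 + d 1 = 0
  · convert hF.isConjCone.smul_mem (d 0 / F (unitTuple K r' c') 0 0) _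
      ⟨unitTuple K r' c', rfl⟩ using 1
    ext i j
    fin_cases i <;> fin_cases j <;> simp [h01', h10', hab', ha']
    linear_combination hd'
  refine hF.diagonal_mem_of_discr hq h2 (x := unitTuple K r c) (y := unitTuple K r' c') ?_ ?_ ?_
    hd hd'
  · rw [Matrix.trace_fin_two, hab, ← two_mul]
    exact hu
  · simp [charDiscr, hab, h01]
  · rw [charDiscr, hab', h01', sub_neg_eq_add, ← two_mul, zero_mul, mul_zero, add_zero]
    exact pow_ne_zero 2 hu'

end Diagonal

/-! ### Consequences of quadratic closedness -/

section QuadraticallyClosed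

variable {K : Type*} [Field K] {m : ℕ}

theorem IsQuadraticallyClosed.exists_root (hK : IsQuadraticallyClosed K m) (hm : 1 ≤ m)
    (a b c : K) (h : a ≠ 0 ∨ b ≠ 0) : ∃ s, a * s ^ 2 + b * s + c = 0 := by
  have hle : (C a * X ^ 2 + C b * X + C c).natDegree ≤ 2 := natDegree_quadratic_le
  have hpos : 0 < (C a * X ^ 2 + C b * X + C c).natDegree := by
    by_cases ha : a = 0
    · have hb : b ≠ 0 := h.resolve_left (not_not.mpr ha)
      simp [ha, natDegree_linear hb]
    · simp [natDegree_quadratic ha]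
  obtain ⟨s, hs⟩ := hK _ hpos (by omega)
  exact ⟨s, by simpa using hs⟩

/-- On a finite field the surjection `s ↦ s ^ 2 + s` would be injective, yet it kills both 0 and -1.
-/
theorem IsQuadraticallyClosed.infinite (hK : IsQuadraticallyClosed K m) (hm : 1 ≤ m) :
    Infinite K := by
  by_contra hfin
  rw [not_infinite_iff_finite] at hfin
  have hsurj : Function.Surjective fun s : K => s ^ 2 + s := fun a => by
    obtain ⟨s, hs⟩ := hK.exists_root hm 1 1 (-a) (by simp)
    exact ⟨s, by linear_combination hs⟩
  have := Finite.injective_iff_surjective.mpr hsurj (a₁ := 0) (a₂ := -1) (by simp)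
  simp at this

end QuadraticallyClosed

/-! ### The set `tildeK` as a single orbit -/

section TildeK

variable {K : Type*} [Field K] {A : Matrix (Fin 2) (Fin 2) K}

theorem trace_det_eq_zero_of_isNilpotent (hA : IsNilpotent A) : A.trace = 0 ∧ A.det = 0 := by
  refine ⟨(Matrix.isNilpotent_trace_of_isNilpotent hA).eq_zero, ?_⟩
  obtain ⟨n, hn⟩ := hA
  have h : A.det ^ (n + 1) = 0 := by
    rw [← Matrix.det_pow, pow_succ, hn, zero_mul, Matrix.det_zero]
  exact pow_eq_zero_iff (Nat.succ_ne_zero n) |>.mp h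

theorem isNilpotent_of_trace_det_eq_zero (ht : A.trace = 0) (hd : A.det = 0) :
    IsNilpotent A := by
  refine ⟨2, ?_⟩
  rw [Matrix.trace_fin_two] at ht
  rw [Matrix.det_fin_two] at hd
  ext i j
  fin_cases i <;> fin_cases j <;> simp [sq, Matrix.mul_apply, Fin.sum_univ_two]
  · linear_combination A 0 0 * ht - hd
  · linear_combination A 0 1 * ht
  · linear_combination A 1 0 * ht
  · linear_combination A 1 1 * ht - hd

theorem isConjCone_isDiagonalizableMatrix :
    IsConjCone {A : Matrix (Fin 2) (Fin 2) K | IsDiagonalizableMatrix A} where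
  conj_mem := by
    rintro g h _ hgh ⟨P, d, rfl⟩
    refine ⟨⟨g, h, hgh, mul_eq_one_comm.mp hgh⟩ * P, d, ?_⟩
    simp [Matrix.mul_assoc, mul_inv_rev]
  smul_mem := by
    rintro c _ ⟨P, d, rfl⟩
    refine ⟨P, c • d, ?_⟩
    rw [Matrix.diagonal_smul, Matrix.mul_smul, Matrix.smul_mul]

theorem diagonal_isDiagonalizableMatrix (d : Fin 2 → K) :
    IsDiagonalizableMatrix (Matrix.diagonal d) := ⟨1, d, by simp⟩

theorem scalarMatrices_subset_diagonalizable (hA : A ∈ scalarMatrices 2 K) :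
    IsDiagonalizableMatrix A := by
  obtain ⟨c, rfl⟩ := hA
  exact diagonal_isDiagonalizableMatrix _

/-- A matrix that is neither nilpotent nor diagonalizable has a nonzero double eigenvalue. -/
theorem exists_double_eigenvalue_of_mem_tildeK
    (hq : ∀ a b c : K, (a ≠ 0 ∨ b ≠ 0) → ∃ s, a * s ^ 2 + b * s + c = 0) (hA : A ∈ tildeK K) :
    ∃ l : K, l ≠ 0 ∧ A.trace = 2 * l ∧ A.det = l ^ 2 := by
  obtain ⟨hnil, hdiag⟩ := hA
  obtain ⟨l, hl⟩ := hq 1 (-A.trace) A.det (by simp)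
  -- The other eigenvalue is `A.trace - l`; were it different, `A` would be diagonalizable.
  have heq : A.trace - l = l := by
    by_contra hne
    refine hdiag (isConjCone_isDiagonalizableMatrix.mem_of_trace_det
      (diagonal_isDiagonalizableMatrix ![l, A.trace - l]) ?_
      (fun h => hdiag (scalarMatrices_subset_diagonalizable h)) ?_ ?_)
    · simpa [mem_scalarMatrices_iff] using fun h => hne h.symm
    · simp
    · simp only [Matrix.det_diagonal, Fin.prod_univ_two, Matrix.cons_val_zero,
        Matrix.cons_val_one]
      linear_combination hl
  have ht : A.trace = 2 * l := by linear_combination heq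
  have hd : A.det = l ^ 2 := by
    rw [ht] at hl
    linear_combination hl
  refine ⟨l, ?_, ht, hd⟩
  rintro rfl
  exact hnil (isNilpotent_of_trace_det_eq_zero (by simpa using ht) (by simpa using hd))

/-- A stable cone containing all diagonal matrices and a nonzero nilpotent one is everything or
everything outside `K̃`. -/
theorem IsConjCone.eq_univ_or_eq_diff_tildeK {S : Set (Matrix (Fin 2) (Fin 2) K)}
    (hS : IsConjCone S) (hq : ∀ a b c : K, (a ≠ 0 ∨ b ≠ 0) → ∃ s, a * s ^ 2 + b * s + c = 0)
    (hdiag : ∀ d, Matrix.diagonal d ∈ S) {n : K} (hn : n ≠ 0) (hnil : !![0, n; 0, 0] ∈ S) :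
    S = Set.univ ∨ S = Set.univ \ tildeK K := by
  have hdS : ∀ A, IsDiagonalizableMatrix A → A ∈ S := by
    rintro _ ⟨P, d, rfl⟩
    exact hS.conj_mem _ _ _ (by simp) (hdiag d)
  have hsub : ∀ A, A ∉ tildeK K → A ∈ S := by
    intro A hA
    by_cases hD : IsDiagonalizableMatrix A
    · exact hdS A hD
    have hN : IsNilpotent A := by
      by_contra h
      exact hA ⟨h, hD⟩
    obtain ⟨ht, hd⟩ := trace_det_eq_zero_of_isNilpotent hN
    exact hS.mem_of_trace_det hnil (by simp [mem_scalarMatrices_iff, hn])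
      (fun h => hD (scalarMatrices_subset_diagonalizable h)) (by simp [ht, Matrix.trace_fin_two])
      (by simp [hd])
  have hns : ∀ A ∈ tildeK K, A ∉ scalarMatrices 2 K :=
    fun A hA h => hA.2 (scalarMatrices_subset_diagonalizable h)
  by_cases hex : ∃ B ∈ S, B ∈ tildeK K
  · left
    obtain ⟨B, hBS, hB⟩ := hex
    refine Set.eq_univ_of_forall fun A => ?_
    by_cases hA : A ∈ tildeK K
    · obtain ⟨l, hl, htA, hdA⟩ := exists_double_eigenvalue_of_mem_tildeK hq hA
      obtain ⟨l', hl', htB, hdB⟩ := exists_double_eigenvalue_of_mem_tildeK hq hB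
      -- Rescaling by the ratio of the double eigenvalues matches trace and determinant.
      refine hS.mem_of_smul_trace_det hBS (hns B hB) (hns A hA) (div_ne_zero hl hl') ?_ ?_
      · rw [htA, htB]
        field_simp
      · rw [hdA, hdB]
        field_simp
    · exact hsub A hA
  · right
    push Not at hex
    ext A
    simp only [Set.mem_sdiff, Set.mem_univ, true_and]
    exact ⟨hex A, hsub A⟩

end TildeK

/-! ### The polynomial as an equivariant multilinear map -/

section Evaluation

variable {K : Type*} [Field K] {m : ℕ}

/-- The multilinear map on `2 × 2` matrices given by the polynomial with coefficients `c`. -/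
def evalMultilinear (c : Equiv.Perm (Fin m) → K) :
    MultilinearMap K (fun _ : Fin m => Matrix (Fin 2) (Fin 2) K) (Matrix (Fin 2) (Fin 2) K) :=
  ∑ σ, c σ • (MultilinearMap.mkPiAlgebraFin K m (Matrix (Fin 2) (Fin 2) K)).domDomCongr σ

theorem evalMultilinear_apply (c : Equiv.Perm (Fin m) → K)
    (a : Fin m → Matrix (Fin 2) (Fin 2) K) :
    evalMultilinear c a = ∑ σ, c σ • (List.ofFn fun i => a (σ i)).prod := by
  simp [evalMultilinear]

theorem list_prod_map_conj {R : Type*} [Ring R] {g h : R} (hgh : g * h = 1) (hhg : h * g = 1)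
    (l : List R) : (l.map fun x => g * x * h).prod = g * l.prod * h := by
  induction l with
  | nil => simp [hgh]
  | cons x l ih =>
    rw [List.map_cons, List.prod_cons, ih, List.prod_cons]
    calc g * x * h * (g * l.prod * h) = g * x * (h * g) * l.prod * h := by noncomm_ring
      _ = _ := by rw [hhg]; noncomm_ring

theorem evalMultilinear_conjEquivariant (c : Equiv.Perm (Fin m) → K) :
    ConjEquivariant (evalMultilinear c) := by
  intro g h hgh x
  simp only [evalMultilinear_apply, Finset.mul_sum, Finset.sum_mul]
  refine Finset.sum_congr rfl fun σ _ => ?_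
  rw [Matrix.mul_smul, Matrix.smul_mul, ← list_prod_map_conj hgh (mul_eq_one_comm.mp hgh),
    List.map_ofFn]
  rfl

theorem polyImage_eq_range (c : Equiv.Perm (Fin m) → K) :
    polyImage (Matrix (Fin 2) (Fin 2) K) (∑ σ : Equiv.Perm (Fin m),
      c σ • (List.ofFn fun i : Fin m => FreeAlgebra.ι K (σ i)).prod) =
      Set.range (evalMultilinear c) := by
  have h : ∀ a : Fin m → Matrix (Fin 2) (Fin 2) K, FreeAlgebra.lift K a
      (∑ σ : Equiv.Perm (Fin m), c σ • (List.ofFn fun i : Fin m => FreeAlgebra.ι K (σ i)).prod) =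
      evalMultilinear c a := by
    intro a
    simp [evalMultilinear_apply, map_list_prod, List.map_ofFn, Function.comp_def]
  ext A
  simp only [polyImage, Set.mem_ofPred_eq, Set.mem_range, h]

end Evaluation

theorem mainTheorem3 {K : Type*} [Field K] {m : ℕ} (hm : 1 ≤ m)
    (hK : IsQuadraticallyClosed K m)
    (p : FreeAlgebra K (Fin m)) (hp : IsMultilinearPoly p) :
    polyImage (Matrix (Fin 2) (Fin 2) K) p = {0} ∨
    polyImage (Matrix (Fin 2) (Fin 2) K) p = scalarMatrices 2 K ∨
    polyImage (Matrix (Fin 2) (Fin 2) K) p = slMatrices 2 K ∨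
    polyImage (Matrix (Fin 2) (Fin 2) K) p = Set.univ ∨
    polyImage (Matrix (Fin 2) (Fin 2) K) p = Set.univ \ tildeK K := by
  obtain ⟨c, rfl⟩ := hp
  rw [polyImage_eq_range]
  have hF := evalMultilinear_conjEquivariant c
  generalize evalMultilinear c = F at hF ⊢
  have : Infinite K := hK.infinite hm
  have : Nonempty (Fin m) := ⟨⟨0, hm⟩⟩
  have hq := hK.exists_root hm
  have hS := hF.isConjCone
  by_cases hns : ∃ x, F x ∉ scalarMatrices 2 K
  · right; right
    by_cases htr : ∃ x, (F x).trace ≠ 0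
    · right
      obtain ⟨r, s, n, hn, h⟩ := hF.exists_strictUpper hns
      exact hS.eq_univ_or_eq_diff_tildeK hq (hF.diagonal_mem hq hns htr) hn ⟨_, h⟩
    · left
      push Not at htr
      refine hF.range_eq_slMatrices (fun a => ?_) hns htr
      obtain ⟨s, hs⟩ := hq 1 0 (-a) (by simp)
      exact ⟨s, by linear_combination hs⟩
  · push Not at hns
    by_cases h0 : ∃ x, F x ≠ 0
    · right; left
      refine Set.Subset.antisymm (by rintro _ ⟨x, rfl⟩; exact hns x) ?_
      rintro _ ⟨b, rfl⟩
      obtain ⟨x, hx⟩ := h0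
      obtain ⟨a, ha⟩ := hns x
      have ha0 : a ≠ 0 := by
        rintro rfl
        exact hx (by rw [ha, map_zero])
      convert hS.smul_mem (b / a) _ ⟨x, ha⟩ using 1
      ext i j
      fin_cases i <;> fin_cases j <;> simp [ha0]
    · left
      push Not at h0
      ext A
      simp [h0, eq_comm]
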